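/- A partial automaton is a triple $(Q,\Sigma,\delta)$ with a finite state set $Q$, a finite alphabet $\Sigma$ and a partial function $\delta\colon Q\times\Sigma\to Q$, extended to words in the usual way; it is complete if $\delta$ is total. The rank of a word $w$ is $|\{\delta(q,w) : q\in Q,\ \delta(q,w)\text{ defined}\}|$. A word of rank $1$ is a reset word; an automaton that has one is synchronizing, and its reset threshold is the length of its shortest reset words. The Černý conjecture states that every synchronizing complete automaton with $n$ states has reset threshold at most $(n-1)^2$. Let $X$ be a finite prefix code over a finite alphabet $\Sigma$, that is, a finite set of non-empty words none of which is a prefix of another. Its literal automaton $\mathscr A_X$ has as states the proper prefixes of the words of $X$ (including the empty word $\varepsilon$ if $X\neq\emptyset$); $\delta(q,x)=\varepsilon$ if $qx\in X$, $\delta(q,x)=qx$ if $qx\notin X$ is a proper prefix of a word of $X$, and $\delta(q,x)$ is undefined otherwise. **Corollary 3.23.** There is an absolute constant $C$ such that, for every finite prefix code $X$ over a finite alphabet, if $\mathscr A_X$ is synchronizing and has $n$ states, then its reset threshold is at most $C\,n\log^3 n$. If the Černý conjecture holds, then there is an absolute constant $C'$ such that, for every finite prefix code $X$ over a finite alphabet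 whose literal automaton is synchronizing with $n$ states, its reset threshold is at most $C'\,n\log^2 n$. -/

import Mathlib

/-- A partial deterministic automaton with states `Q` and input alphabet `α`;
`step q a = none` means that the transition of `q` under `a` is undefined. -/
structure PartialAutomaton (Q : Type*) (α : Type*) where
  step : Q → α → Option Q

namespace PartialAutomaton

variable {Q α : Type*}

/-- The extension of the transition function to words; `none` means undefined. -/
def run (A : PartialAutomaton Q α) (q : Q) : List α → Option Q
  | [] => some q
  | a :: w => (A.step q a).bind fun p => A.run p w

/-- The recursion on the last letter: `δ(q, wa) = δ(δ(q, w), a)`. -/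
theorem run_append_singleton (A : PartialAutomaton Q α) (q : Q) (w : List α) (a : α) :
    A.run q (w ++ [a]) = (A.run q w).bind fun p => A.step p a := by
  induction w generalizing q with
  | nil => simp [run]
  | cons b w ih => simp [run, ih, Option.bind_assoc]

/-- The image `δ(S, w)` of a set of states under the action of a word. -/
def image (A : PartialAutomaton Q α) (S : Set Q) (w : List α) : Set Q :=
  {p | ∃ q ∈ S, A.run q w = some p}

/-- The rank of a word: the number of states in the image of the whole state set. -/
noncomputable def rank (A : PartialAutomaton Q α) (w : List α) : ℕ :=
  (A.image Set.univ w).ncard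

/-- A reset word is a word of rank `1`. -/
def IsReset (A : PartialAutomaton Q α) (w : List α) : Prop :=
  A.rank w = 1

/-- An automaton is synchronizing if it has a reset word. -/
def IsSynchronizing (A : PartialAutomaton Q α) : Prop :=
  ∃ w : List α, A.IsReset w

/-- The reset threshold: the length of the shortest reset words
(meaningful for synchronizing automata only). -/
noncomputable def resetThreshold (A : PartialAutomaton Q α) : ℕ :=
  sInf {l | ∃ w : List α, A.IsReset w ∧ w.length = l}

/-- An automaton is complete if all its transitions are defined. -/
def IsComplete (A : PartialAutomaton Q α) : Prop :=
  ∀ (q : Q) (a : α), ∃ p : Q, A.step q a = some p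

end PartialAutomaton

/-- The Černý conjecture: every synchronizing complete automaton with `n` states has a reset word
of length at most `(n - 1) ^ 2`. (A synchronizing automaton has at least one state, so the
subtraction never truncates.) -/
def CernyConjecture : Prop :=
  ∀ (Q α : Type) [Finite Q] [Finite α] (A : PartialAutomaton Q α),
    A.IsComplete → A.IsSynchronizing → A.resetThreshold ≤ (Nat.card Q - 1) ^ 2

/-- A prefix code: a set of non-empty words none of which is a prefix of another one. -/
def IsPrefixCode {α : Type*} (X : Set (List α)) : Prop :=
  [] ∉ X ∧ ∀ u ∈ X, ∀ v ∈ X, u <+: v → u = v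

/-- `u` is a proper prefix of some word of `X`. -/
def IsProperPrefixIn {α : Type*} (X : Set (List α)) (u : List α) : Prop :=
  ∃ v ∈ X, u <+: v ∧ u ≠ v

/-- The states of the literal automaton of `X`: the proper prefixes of the words of `X`. -/
abbrev LiteralState {α : Type*} (X : Set (List α)) : Type _ :=
  {u : List α // IsProperPrefixIn X u}

open Classical in
/-- The literal automaton of `X`: `δ(q, a) = ε` if `qa ∈ X`, `δ(q, a) = qa` if `qa ∉ X` is a proper
prefix of a word of `X`, and `δ(q, a)` is undefined otherwise. -/
noncomputable def literalAutomaton {α : Type*} (X : Set (List α)) :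
    PartialAutomaton (LiteralState X) α where
  step q a :=
    if h : q.1 ++ [a] ∈ X then some ⟨[], q.1 ++ [a], h, List.nil_prefix, by simp⟩
    else if h' : IsProperPrefixIn X (q.1 ++ [a]) then some ⟨q.1 ++ [a], h'⟩
    else none

/-!
The literal automaton `A` of a finite prefix code is strongly connected, so it suffices to have a
word `w` of linear length whose rank `r ≥ 1` is logarithmic in the number `n` of states, and to
pass from `w` to a reset word at the cost of `r ^ k` further words of linear length. Here `k` is
such that complete synchronizing automata with `r` states have reset words of length at most
`r ^ k`: merging pairs of states one after another gives `k = 3`, and the Černý conjecture gives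
`k = 2`.

*Small rank* (`IsBranchingWeight.exists_word_rank`, `literalAutomaton.exists_word_rank`). If the
code has at least two words, let `b` be their longest common prefix. Every path visits `b` within
`2 n` steps, and two letters are defined at `b`. Away from `b` the paths descend in a tree, and
the two letters lead into disjoint subtrees. Hence, whenever `b` is reached, one of them halves the
total size of the subtrees below the current states. Weighting the subtree of a state with
`(3 / 2) ^ k`, where `k` counts the later visits to `b`, keeps this total at most `4 (n + 1)`; so
after `2 n` letters there are only logarithmically many ages `k`, with one state for each. A code
with one word has a cycle as literal automaton, and is treated directly
(`literalAutomaton.resetThreshold_singleton_le`).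

*From small rank to rank one* (`IsSynchronizing.exists_fixing_const`,
`IsSynchronizing.resetThreshold_le`). The words `uw` with `u` of linear length act on the image `R`
of `w`; fixing the states of `R` at which `uw` is undefined makes these actions total. A product of
them that is constant yields a reset word of `A`, by skipping the factors undefined on all current
states. Such a product exists: otherwise, on an image of minimal size, each short `uw` is defined
everywhere or nowhere, which gives a linear condition on the action of `u`. It holds for all `u` by
a dimension argument (`pullback_eq_zero_of_short`), but fails for words through a reset word.
-/

namespace PartialAutomaton

variable {Q α : Type*}

/-! ### Words acting on states, sets of states and functions -/

theorem run_append (A : PartialAutomaton Q α) (q : Q) (u v : List α) :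
    A.run q (u ++ v) = (A.run q u).bind fun p => A.run p v := by
  induction u generalizing q with
  | nil => simp [run]
  | cons a u ih => simp [run, ih, Option.bind_assoc]

theorem run_append_eq_some (A : PartialAutomaton Q α) {q r : Q} {u v : List α} :
    A.run q (u ++ v) = some r ↔ ∃ p, A.run q u = some p ∧ A.run p v = some r := by
  rw [run_append, Option.bind_eq_some_iff]

theorem image_append (A : PartialAutomaton Q α) (S : Set Q) (u v : List α) :
    A.image S (u ++ v) = A.image (A.image S u) v := by
  ext r
  simp only [image, Set.mem_ofPred_eq, run_append_eq_some]
  constructor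
  · rintro ⟨q, hq, p, hp, hr⟩
    exact ⟨p, ⟨q, hq, hp⟩, hr⟩
  · rintro ⟨p, ⟨q, hq, hp⟩, hr⟩
    exact ⟨q, hq, p, hp, hr⟩

theorem image_mono (A : PartialAutomaton Q α) {S T : Set Q} (h : S ⊆ T) (w : List α) :
    A.image S w ⊆ A.image T w := fun _ ⟨q, hq, hr⟩ => ⟨q, h hq, hr⟩

theorem image_univ_append_subset (A : PartialAutomaton Q α) (u v : List α) :
    A.image Set.univ (u ++ v) ⊆ A.image Set.univ v := by
  rw [image_append]
  exact A.image_mono (Set.subset_univ _) v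

theorem IsReset.exists_image_eq {A : PartialAutomaton Q α} {w : List α} (h : A.IsReset w) :
    ∃ t, A.image Set.univ w = {t} := Set.ncard_eq_one.1 h

theorem isReset_of_subset_singleton {A : PartialAutomaton Q α} {w : List α} {t : Q}
    (hne : (A.image Set.univ w).Nonempty) (h : A.image Set.univ w ⊆ {t}) : A.IsReset w :=
  Set.ncard_eq_one.2 ⟨t, hne.subset_singleton_iff.1 h⟩

theorem IsReset.resetThreshold_le {A : PartialAutomaton Q α} {w : List α} (h : A.IsReset w) :
    A.resetThreshold ≤ w.length := Nat.sInf_le ⟨w, h, rfl⟩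

/-- A word acts linearly on functions on states by composition, with value `0` where the word is
undefined. -/
def pullback (A : PartialAutomaton Q α) (w : List α) : (Q → ℚ) →ₗ[ℚ] (Q → ℚ) where
  toFun f q := (A.run q w).elim 0 f
  map_add' f g := by ext q; cases h : A.run q w <;> simp [h]
  map_smul' c f := by ext q; cases h : A.run q w <;> simp [h]

theorem pullback_apply (A : PartialAutomaton Q α) (w : List α) (f : Q → ℚ) (q : Q) :
    A.pullback w f q = (A.run q w).elim 0 f := rfl

theorem pullback_append (A : PartialAutomaton Q α) (u v : List α) (f : Q → ℚ) :
    A.pullback (u ++ v) f = A.pullback u (A.pullback v f) := by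
  ext q
  rw [pullback_apply, run_append, pullback_apply]
  cases A.run q u <;> simp [pullback_apply]

end PartialAutomaton

/-- Among `finrank + 1` vectors, one lies in the span of its predecessors. -/
theorem exists_mem_span_image_Iio {K V : Type*} [DivisionRing K] [AddCommGroup V] [Module K V]
    [FiniteDimensional K V] (v : ℕ → V) :
    ∃ j ≤ Module.finrank K V, v j ∈ Submodule.span K (v '' Set.Iio j) := by
  by_contra! h
  have key : ∀ j ≤ Module.finrank K V + 1,
      j ≤ Module.finrank K (Submodule.span K (v '' Set.Iio j)) := by
    intro j
    induction j with
    | zero => simp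
    | succ j ih =>
      intro hj
      have hlt : Submodule.span K (v '' Set.Iio j) < Submodule.span K (v '' Set.Iio (j + 1)) := by
        refine lt_of_le_of_ne (Submodule.span_mono (Set.image_mono fun i (hi : i < j) =>
          Nat.lt_succ_of_lt hi)) fun he => h j (by omega) ?_
        rw [he]
        exact Submodule.subset_span ⟨j, Nat.lt_succ_self j, rfl⟩
      have := Submodule.finrank_lt_finrank_of_lt hlt
      have := ih (by omega)
      omega
  have h1 := key _ le_rfl
  have h2 := Submodule.finrank_le (Submodule.span K (v '' Set.Iio (Module.finrank K V + 1)))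
  omega

namespace PartialAutomaton

variable {Q α : Type*}

/-- A linear condition on the action of words that holds for all words shorter than the number of
states holds for all words: some suffix of a longer word acts as a combination of shorter
suffixes. -/
theorem pullback_eq_zero_of_short [Finite Q] (A : PartialAutomaton Q α) (φ : (Q → ℚ) →ₗ[ℚ] ℚ)
    (g : Q → ℚ) (h : ∀ u : List α, u.length < Nat.card Q → φ (A.pullback u g) = 0)
    (u : List α) : φ (A.pullback u g) = 0 := by
  induction hm : u.length using Nat.strong_induction_on generalizing u with
  | _ m ih =>
    by_cases hu : u.length < Nat.card Q
    · exact h u hu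
    have := Fintype.ofFinite Q
    obtain ⟨j, hj, hmem⟩ := exists_mem_span_image_Iio (K := ℚ)
      fun j => A.pullback (u.drop (m - j)) g
    rw [Module.finrank_fintype_fun_eq_card, ← Nat.card_eq_fintype_card] at hj
    have hle : Submodule.span ℚ ((fun j => A.pullback (u.drop (m - j)) g) '' Set.Iio j) ≤
        LinearMap.ker (φ ∘ₗ A.pullback (u.take (m - j))) := by
      rw [Submodule.span_le]
      rintro _ ⟨i, hi, rfl⟩
      have hi : i < j := hi
      simp only [SetLike.mem_coe, LinearMap.mem_ker, LinearMap.comp_apply, ← pullback_append]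
      refine ih _ ?_ _ rfl
      simp only [List.length_append, List.length_take, List.length_drop]
      omega
    have := hle hmem
    rwa [LinearMap.mem_ker, LinearMap.comp_apply, ← pullback_append, List.take_append_drop] at this

end PartialAutomaton

/-! ### Short reset words of complete automata -/

/-- Every system of transformations of a nonempty finite set `Q`, indexed by `β`, with some
composition constant has a constant composition of at most `|Q| ^ k` of them. -/
def HasShortResets.{u, v} (k : ℕ) : Prop :=
  ∀ (Q : Type u) (β : Type v) [Finite Q] [Nonempty Q] (step : Q → β → Q),
    (∃ (l : List β) (t : Q), ∀ q, l.foldl step q = t) →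
      ∃ (l : List β) (t : Q), l.length ≤ Nat.card Q ^ k ∧ ∀ q, l.foldl step q = t

/-- A word merging two states can be shortened to have length at most `|Q| ^ 2`, by cutting
cycles in the automaton of pairs. -/
theorem exists_short_merging {Q β : Type*} [Finite Q] (step : Q → β → Q) {p q : Q} {l : List β}
    (h : l.foldl step p = l.foldl step q) :
    ∃ l' : List β, l'.length ≤ Nat.card Q ^ 2 ∧ l'.foldl step p = l'.foldl step q := by
  have := Fintype.ofFinite Q
  let M : DFA β (Q × Q) := ⟨fun s a => (step s.1 a, step s.2 a), (p, q), ∅⟩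
  have hM : ∀ (l : List β) (s : Q × Q),
      M.evalFrom s l = (l.foldl step s.1, l.foldl step s.2) := by
    intro l
    induction l with
    | nil => simp
    | cons a l ih => intro s; simp [DFA.evalFrom_cons, ih, M]
  induction hm : l.length using Nat.strong_induction_on generalizing l with
  | _ m ih =>
    by_cases hl : l.length < Fintype.card (Q × Q)
    · refine ⟨l, ?_, h⟩
      rw [Fintype.card_prod, ← Nat.card_eq_fintype_card] at hl
      rw [pow_two]; exact hl.le
    · obtain ⟨s, a, b, c, rfl, -, hb, h1, h2, h3⟩ :=
        M.evalFrom_split (not_lt.1 hl) (hM l (p, q))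
      have hac : M.evalFrom (p, q) (a ++ c) =
          ((a ++ b ++ c).foldl step p, (a ++ b ++ c).foldl step q) := by
        rw [DFA.evalFrom_of_append, h1, h3]
      rw [hM, Prod.mk.injEq] at hac
      refine ih (a ++ c).length ?_ (l := a ++ c) (by rw [hac.1, hac.2]; exact h) rfl
      have := List.length_pos_iff.2 hb
      simp only [List.length_append] at hm ⊢
      omega

theorem hasShortResets_three : HasShortResets 3 := by
  intro Q β _ _ step ⟨l, t, hl⟩
  have := Fintype.ofFinite Q
  classical
  -- Merge pairs one at a time: each merging decreases the image.
  have key : ∀ (m : ℕ) (S : Finset Q), S.Nonempty → S.card ≤ m + 1 →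
      ∃ (l : List β) (t : Q), l.length ≤ m * Nat.card Q ^ 2 ∧ ∀ q ∈ S, l.foldl step q = t := by
    intro m
    induction m with
    | zero =>
      intro S hS hc
      obtain ⟨s, hs⟩ := hS
      exact ⟨[], s, by simp, fun q hq => Finset.card_le_one.1 (by omega) q hq s hs⟩
    | succ m ih =>
      intro S hS hc
      by_cases h1 : S.card ≤ 1
      · obtain ⟨s, hs⟩ := hS
        exact ⟨[], s, by simp, fun q hq => Finset.card_le_one.1 h1 q hq s hs⟩
      obtain ⟨p, hp, q, hq, hpq⟩ := Finset.one_lt_card.1 (not_le.1 h1)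
      obtain ⟨l₁, hl₁, he⟩ := exists_short_merging step (p := p) (q := q) (l := l)
        ((hl p).trans (hl q).symm)
      have hlt : (S.image fun s => l₁.foldl step s).card < S.card := by
        refine lt_of_le_of_ne Finset.card_image_le fun hc => hpq ?_
        exact Finset.card_image_iff.1 hc hp hq he
      obtain ⟨l₂, t, hl₂, ht⟩ := ih _ (hS.image fun s => l₁.foldl step s) (by omega)
      refine ⟨l₁ ++ l₂, t, ?_, fun q hq => ?_⟩
      · rw [List.length_append, add_mul, one_mul]; omega
      · rw [List.foldl_append]
        exact ht _ (Finset.mem_image_of_mem _ hq)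
  obtain ⟨l, t, hl, ht⟩ := key (Nat.card Q) Finset.univ Finset.univ_nonempty
    (by rw [Finset.card_univ, Nat.card_eq_fintype_card]; omega)
  exact ⟨l, t, hl.trans_eq (pow_succ' _ 2).symm, fun q => ht q (Finset.mem_univ q)⟩

/-- The complete automaton of a system of total transformations. -/
def PartialAutomaton.ofTotal {Q α : Type*} (step : Q → α → Q) : PartialAutomaton Q α :=
  ⟨fun q a => some (step q a)⟩

theorem PartialAutomaton.run_ofTotal {Q α : Type*} (step : Q → α → Q) (q : Q) (w : List α) :
    (PartialAutomaton.ofTotal step).run q w = some (w.foldl step q) := by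
  induction w generalizing q with
  | nil => rfl
  | cons a w ih => simp only [run, ofTotal, Option.bind_some, List.foldl_cons]; exact ih _

theorem PartialAutomaton.isReset_ofTotal_iff {Q α : Type*} [Nonempty Q] (step : Q → α → Q)
    (w : List α) :
    (PartialAutomaton.ofTotal step).IsReset w ↔ ∃ t, ∀ q, w.foldl step q = t := by
  have himg : (ofTotal step).image Set.univ w = Set.range fun q => w.foldl step q := by
    ext r
    simp [image, run_ofTotal]
  rw [IsReset, rank, himg, Set.ncard_eq_one]
  refine exists_congr fun t => ?_
  constructor
  · intro h q
    exact h.subset (Set.mem_range_self q)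
  · intro h
    exact (Set.range_nonempty _).subset_singleton_iff.1 (Set.range_subset_iff.2 h)

/-- The conjecture concerns small types with finite alphabets; a system of transformations of `Q`
is transported to `Fin |Q|`, with the set of transformations that occur as the alphabet. -/
theorem CernyConjecture.hasShortResets_two (hC : CernyConjecture) : HasShortResets 2 := by
  intro Q β _ _ step ⟨l, t, hl⟩
  let e : Q ≃ Fin (Nat.card Q) := Finite.equivFin Q
  let f : β → Fin (Nat.card Q) → Fin (Nat.card Q) := fun b i => e (step (e.symm i) b)
  let step' : Fin (Nat.card Q) → Set.range f → Fin (Nat.card Q) := fun i g => g.1 i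
  have hstep : ∀ (m : List β) (q : Q),
      (m.map (Set.rangeFactorization f)).foldl step' (e q) = e (m.foldl step q) := by
    intro m
    induction m with
    | nil => simp
    | cons b m ih =>
      intro q
      rw [List.map_cons, List.foldl_cons, List.foldl_cons, ← ih]
      simp [step', f, Set.rangeFactorization]
  have : Nonempty (Fin (Nat.card Q)) := ⟨e t⟩
  have hsync : (PartialAutomaton.ofTotal step').IsSynchronizing := by
    refine ⟨l.map (Set.rangeFactorization f),
      (PartialAutomaton.isReset_ofTotal_iff _ _).2 ⟨e t, fun i => ?_⟩⟩
    rw [← e.apply_symm_apply i, hstep, hl]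
  obtain ⟨w, hw, hlen⟩ : (PartialAutomaton.ofTotal step').resetThreshold ∈
      {l | ∃ w, (PartialAutomaton.ofTotal step').IsReset w ∧ w.length = l} :=
    Nat.sInf_mem (let ⟨w, hw⟩ := hsync; ⟨_, w, hw, rfl⟩)
  obtain ⟨m, rfl⟩ : ∃ m : List β, m.map (Set.rangeFactorization f) = w :=
    List.map_surjective_iff.2 Set.rangeFactorization_surjective w
  obtain ⟨i, hi⟩ := (PartialAutomaton.isReset_ofTotal_iff _ _).1 hw
  refine ⟨m, e.symm i, ?_, fun q => by rw [← hi (e q), hstep, e.symm_apply_apply]⟩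
  have := hC _ _ (PartialAutomaton.ofTotal step') (fun q a => ⟨_, rfl⟩) hsync
  rw [← hlen, List.length_map, Nat.card_fin] at this
  exact this.trans (Nat.pow_le_pow_left (Nat.sub_le _ _) 2)

/-! ### From a word of small rank to a reset word -/

namespace PartialAutomaton

variable {Q α : Type*}

/-- Every state can be reached from every state by a word of length at most `D`. -/
def IsConnectedWithin (A : PartialAutomaton Q α) (D : ℕ) : Prop :=
  ∀ p q, ∃ v : List α, v.length ≤ D ∧ A.run p v = some q

open Classical in
/-- The action on the image of `w` of a word `u` followed by `w`, completed so that it fixes the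
states at which `uw` is undefined. -/
noncomputable def fixingStep (A : PartialAutomaton Q α) (w : List α)
    (p : A.image Set.univ w) (u : List α) : A.image Set.univ w :=
  if h : ∃ r, A.run p (u ++ w) = some r then
    ⟨h.choose, A.image_univ_append_subset u w ⟨p, Set.mem_univ _, h.choose_spec⟩⟩
  else p

theorem fixingStep_of_eq_some (A : PartialAutomaton Q α) {w u : List α}
    {p : A.image Set.univ w} {r : Q} (h : A.run p (u ++ w) = some r) :
    (A.fixingStep w p u : Q) = r := by
  have hex : ∃ r, A.run p (u ++ w) = some r := ⟨r, h⟩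
  rw [fixingStep, dif_pos hex]
  exact Option.some_injective _ (hex.choose_spec.symm.trans h)

theorem fixingStep_of_eq_none (A : PartialAutomaton Q α) {w u : List α}
    {p : A.image Set.univ w} (h : A.run p (u ++ w) = none) : A.fixingStep w p u = p := by
  rw [fixingStep, dif_neg]
  simp [h]

/-- A composition of completed actions dominates a word of the automaton: the words undefined on
the whole current set of states are skipped. -/
theorem exists_word_of_fixing (A : PartialAutomaton Q α) (w : List α) (M : ℕ)
    (l : List (List α)) (hl : ∀ u ∈ l, u.length ≤ M) (S : Set (A.image Set.univ w))
    (hS : S.Nonempty) :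
    ∃ v : List α, v.length ≤ l.length * (M + w.length) ∧
      (A.image (Subtype.val '' S) v).Nonempty ∧
      A.image (Subtype.val '' S) v ⊆
        (fun p : A.image Set.univ w =>
          ((l.foldl (A.fixingStep w) p : A.image Set.univ w) : Q)) '' S := by
  induction l generalizing S with
  | nil =>
    obtain ⟨s, hs⟩ := hS
    refine ⟨[], by simp, ⟨s, s, ⟨s, hs, rfl⟩, rfl⟩, ?_⟩
    rintro r ⟨_, ⟨p, hp, rfl⟩, hr⟩
    exact ⟨p, hp, Option.some_injective _ hr⟩
  | cons u l ih =>
    have hu : u.length ≤ M := hl u (by simp)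
    have hl' : ∀ u ∈ l, u.length ≤ M := fun u hu => hl u (by simp [hu])
    by_cases hex : ∃ p ∈ S, ∃ r, A.run p (u ++ w) = some r
    · obtain ⟨p, hp, r, hr⟩ := hex
      let S' : Set (A.image Set.univ w) :=
        {s | ∃ p ∈ S, A.run p (u ++ w) = some s.1}
      have hS' : S'.Nonempty :=
        ⟨⟨r, A.image_univ_append_subset u w ⟨p, Set.mem_univ _, hr⟩⟩, p, hp, hr⟩
      obtain ⟨v, hv, hne, hsub⟩ := ih hl' S' hS'
      have himg : A.image (Subtype.val '' S) (u ++ w) = Subtype.val '' S' := by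
        ext s
        constructor
        · rintro ⟨_, ⟨p, hp, rfl⟩, hs⟩
          exact ⟨⟨s, A.image_univ_append_subset u w ⟨p, Set.mem_univ _, hs⟩⟩, ⟨p, hp, hs⟩, rfl⟩
        · rintro ⟨s, ⟨p, hp, hs⟩, rfl⟩
          exact ⟨p, ⟨p, hp, rfl⟩, hs⟩
      refine ⟨u ++ w ++ v, ?_, by rwa [image_append, himg], ?_⟩
      · simp only [List.length_append, List.length_cons, add_mul, one_mul]
        omega
      · rw [image_append, himg]
        refine hsub.trans ?_
        rintro _ ⟨s, ⟨p, hp, hs⟩, rfl⟩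
        refine ⟨p, hp, ?_⟩
        have : A.fixingStep w p u = s := Subtype.ext (A.fixingStep_of_eq_some hs)
        simp only [List.foldl_cons, this]
    · push Not at hex
      obtain ⟨v, hv, hne, hsub⟩ := ih hl' S hS
      refine ⟨v, hv.trans (Nat.mul_le_mul_right _ (by simp)), hne, hsub.trans ?_⟩
      rintro _ ⟨p, hp, rfl⟩
      refine ⟨p, hp, ?_⟩
      have : A.fixingStep w p u = p :=
        A.fixingStep_of_eq_none (Option.eq_none_iff_forall_ne_some.2 (hex p hp))
      simp only [List.foldl_cons, this]

/-- If a strongly connected partial automaton is synchronizing, then so is the complete system of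
the actions of `uw`, with `u` short, on the image of `w`.

Let `F` be an image of minimal size `ρ` under compositions of these actions. A short word defined
at `p ∈ F` and undefined at `q ∈ F` could be continued by a path to `q`, which merges `p` with `q`.
So short words are defined on all of `F` or nowhere on `F`, and in both cases a linear condition
holds that a reset word contradicts when `ρ > 1`. -/
theorem IsSynchronizing.exists_fixing_const [Finite Q] {A : PartialAutomaton Q α}
    (hA : A.IsSynchronizing) {D : ℕ} (hD : A.IsConnectedWithin D) {w : List α}
    (hw : (A.image Set.univ w).Nonempty) :
    ∃ (l : List (List α)) (t : A.image Set.univ w),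
      (∀ u ∈ l, u.length ≤ Nat.card Q + w.length + D) ∧
        ∀ p, l.foldl (A.fixingStep w) p = t := by
  classical
  have := Fintype.ofFinite Q
  have := Fintype.ofFinite (A.image Set.univ w)
  have : Nonempty (A.image Set.univ w) := hw.to_subtype
  let M := Nat.card Q + w.length + D
  let L : Set (List (List α)) := {l | ∀ u ∈ l, u.length ≤ M}
  let φ : List (List α) → A.image Set.univ w → A.image Set.univ w :=
    fun l p => l.foldl (A.fixingStep w) p
  have hφ : ∀ l m p, φ (l ++ m) p = φ m (φ l p) := fun l m p => List.foldl_append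
  obtain ⟨z, hz, hmin⟩ : ∃ z ∈ L, ∀ l ∈ L,
      (Finset.univ.image (φ z)).card ≤ (Finset.univ.image (φ l)).card := by
    obtain ⟨z, hz, h⟩ := (measure fun l => (Finset.univ.image (φ l)).card).wf.has_min L
      ⟨[], by simp [L]⟩
    exact ⟨z, hz, fun l hl => not_lt.1 (h l hl)⟩
  set F := Finset.univ.image (φ z) with hF
  have hLapp : ∀ {l m}, l ∈ L → m ∈ L → l ++ m ∈ L := by
    intro l m hl hm u hu
    rcases List.mem_append.1 hu with h | h
    exacts [hl u h, hm u h]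
  -- Compositions act injectively on `F` by minimality.
  have hinj : ∀ l ∈ L, Set.InjOn (φ l) F := by
    intro l hl
    rw [← Finset.card_image_iff]
    refine le_antisymm Finset.card_image_le ((hmin _ (hLapp hz hl)).trans_eq ?_)
    rw [hF, Finset.image_image]
    congr 1
    exact Finset.image_congr fun p _ => hφ _ _ _
  have hFne : F.Nonempty := Finset.univ_nonempty.image _
  by_cases hρ : F.card ≤ 1
  · obtain ⟨t, ht⟩ := hFne
    exact ⟨z, t, hz, fun p =>
      Finset.card_le_one.1 hρ _ (Finset.mem_image_of_mem _ (Finset.mem_univ p)) t ht⟩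
  exfalso
  obtain ⟨t₀, ht₀⟩ := hFne
  -- Each composition puts exactly one state of `F` into the fibre of `φ z` over `t₀`.
  have hfib : ∀ l ∈ L, (F.filter fun p => φ z (φ l p) = t₀).card = 1 := by
    intro l hl
    have hinj' : Set.InjOn (fun p => φ z (φ l p)) F := by
      intro p hp q hq h
      exact hinj (l ++ z) (hLapp hl hz) hp hq (by rw [hφ, hφ]; exact h)
    have himg : F.image (fun p => φ z (φ l p)) = F := by
      refine Finset.eq_of_subset_of_card_le ?_ (Finset.card_image_of_injOn hinj').ge
      intro r hr
      obtain ⟨p, -, rfl⟩ := Finset.mem_image.1 hr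
      exact Finset.mem_image_of_mem _ (Finset.mem_univ _)
    obtain ⟨p, hp, hpt⟩ := Finset.mem_image.1 (himg.symm ▸ ht₀)
    refine Finset.card_eq_one.2 ⟨p, ?_⟩
    ext q
    simp only [Finset.mem_filter, Finset.mem_singleton]
    constructor
    · rintro ⟨hq, h⟩
      exact hinj' hq hp (h.trans hpt.symm)
    · rintro rfl
      exact ⟨hp, hpt⟩
  -- Short words are defined on all of `F` or nowhere on `F`.
  have hdom : ∀ u : List α, u.length < Nat.card Q → ∀ p ∈ F, ∀ q ∈ F, ∀ r,
      A.run p (u ++ w) = some r → A.run q (u ++ w) ≠ none := by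
    intro u hu p hp q hq r hr hn
    obtain ⟨q₀, -, hq₀⟩ := q.2
    obtain ⟨v, hv, hrv⟩ := hD r q₀
    have hm : [u ++ w ++ v] ∈ L := by
      intro x hx
      rw [List.mem_singleton.1 hx]
      simp only [List.length_append, M]
      omega
    have h1 : A.fixingStep w p (u ++ w ++ v) = q := by
      refine Subtype.ext (A.fixingStep_of_eq_some ?_)
      rw [run_append_eq_some]
      exact ⟨q₀, A.run_append_eq_some.2 ⟨r, hr, hrv⟩, hq₀⟩
    have h2 : A.fixingStep w q (u ++ w ++ v) = q := by
      refine A.fixingStep_of_eq_none ?_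
      rw [List.append_assoc, run_append, hn]
      rfl
    have hpq : p = q := hinj _ hm hp hq (h1.trans h2.symm)
    rw [hpq, hn] at hr
    simp at hr
  let κ : Q → ℚ := fun r => (if ∃ s : A.image Set.univ w, s.1 = r ∧ φ z s = t₀ then 1 else 0) -
    (F.card : ℚ)⁻¹
  have hκ : ∀ s : A.image Set.univ w, κ s = (if φ z s = t₀ then 1 else 0) - (F.card : ℚ)⁻¹ := by
    intro s
    simp only [κ]
    congr 2
    apply propext
    constructor
    · rintro ⟨s', h, h'⟩
      rwa [← Subtype.ext h]
    · exact fun h => ⟨s, rfl, h⟩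
  have hρ0 : (F.card : ℚ) ≠ 0 := by
    have : F.card ≠ 0 := by omega
    exact_mod_cast this
  let Φ : (Q → ℚ) →ₗ[ℚ] ℚ := ∑ p ∈ F, LinearMap.proj (p : Q)
  have hΦ : ∀ u, Φ (A.pullback u (A.pullback w κ)) = ∑ p ∈ F, (A.run p (u ++ w)).elim 0 κ := by
    intro u
    rw [← pullback_append]
    simp [Φ, pullback_apply]
  have hzero : ∀ u, Φ (A.pullback u (A.pullback w κ)) = 0 := by
    refine A.pullback_eq_zero_of_short Φ _ fun u hu => ?_
    rw [hΦ]
    by_cases hex : ∃ p ∈ F, ∃ r, A.run p (u ++ w) = some r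
    · obtain ⟨p, hp, r, hr⟩ := hex
      have hstep : ∀ q ∈ F, (A.run q (u ++ w)).elim 0 κ = κ (A.fixingStep w q u) := by
        intro q hq
        obtain ⟨s, hs⟩ := Option.ne_none_iff_exists'.1 (hdom u hu p hp q hq r hr)
        rw [A.fixingStep_of_eq_some hs, hs]
        rfl
      have hm : [u] ∈ L := by
        intro x hx
        rw [List.mem_singleton.1 hx]
        simp only [M]
        omega
      have h1 := hfib _ hm
      rw [Finset.sum_congr rfl hstep]
      simp only [hκ]
      rw [Finset.sum_sub_distrib, Finset.sum_boole, Finset.sum_const, nsmul_eq_mul,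
        mul_inv_cancel₀ hρ0, sub_eq_zero]
      exact_mod_cast h1
    · push Not at hex
      refine Finset.sum_eq_zero fun p hp => ?_
      rw [Option.eq_none_iff_forall_ne_some.2 (hex p hp)]
      rfl
  -- A word through a reset word sends the states of `F` where it is defined, among them `t₀`, to
  -- one state.
  obtain ⟨y, hy⟩ := hA
  obtain ⟨t, ht⟩ := hy.exists_image_eq
  obtain ⟨s, -, hs⟩ : t ∈ A.image Set.univ y := by rw [ht]; rfl
  obtain ⟨t', s', -, hs'⟩ := hw
  obtain ⟨v₁, -, hv₁⟩ := hD t₀ s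
  obtain ⟨v₂, -, hv₂⟩ := hD t s'
  have hall : ∀ p r, A.run p (v₁ ++ y ++ v₂ ++ w) = some r → r = t' := by
    intro p r hr
    rw [run_append_eq_some] at hr
    obtain ⟨b, hb, hr⟩ := hr
    rw [run_append_eq_some] at hb
    obtain ⟨c, hc, hb⟩ := hb
    have : c ∈ A.image Set.univ y :=
      A.image_univ_append_subset v₁ y ⟨p, Set.mem_univ _, hc⟩
    rw [ht] at this
    rw [this, hv₂] at hb
    rw [← Option.some_injective _ hb, hs'] at hr
    exact (Option.some_injective _ hr).symm
  have ht₀' : A.run t₀ (v₁ ++ y ++ v₂ ++ w) = some t' := by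
    simp only [run_append_eq_some]
    exact ⟨s', ⟨t, ⟨s, hv₁, hs⟩, hv₂⟩, hs'⟩
  have hκt : κ t' ≠ 0 := by
    have h1 : (1 : ℚ) < F.card := by exact_mod_cast not_le.1 hρ
    have h2 : (F.card : ℚ)⁻¹ < 1 := inv_lt_one_of_one_lt₀ h1
    have h3 : 0 < (F.card : ℚ)⁻¹ := by positivity
    simp only [κ]
    split_ifs
    · linarith
    · linarith
  have hval : ∀ p ∈ F, (A.run p (v₁ ++ y ++ v₂ ++ w)).elim 0 κ =
      (if (A.run p (v₁ ++ y ++ v₂ ++ w)).isSome then 1 else 0) * κ t' := by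
    intro p _
    cases h : A.run p (v₁ ++ y ++ v₂ ++ w) with
    | none => simp
    | some r => simp [hall _ _ h]
  have hsum := hzero (v₁ ++ y ++ v₂)
  rw [hΦ, Finset.sum_congr rfl hval, ← Finset.sum_mul, Finset.sum_boole] at hsum
  have hc := (mul_eq_zero.1 hsum).resolve_right hκt
  have hc : (F.filter fun p : A.image Set.univ w =>
      (A.run p (v₁ ++ y ++ v₂ ++ w)).isSome).card = 0 := by exact_mod_cast hc
  rw [Finset.card_eq_zero] at hc
  have : t₀ ∈ F.filter fun p : A.image Set.univ w =>
      (A.run p (v₁ ++ y ++ v₂ ++ w)).isSome := by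
    rw [Finset.mem_filter, ht₀']
    exact ⟨ht₀, rfl⟩
  rw [hc] at this
  simp at this

/-- In a strongly connected synchronizing partial automaton, a word of rank `r` extends to a reset
word by at most `r ^ k` words, each of length linear in the number of states, the length of the
word and the diameter. -/
theorem IsSynchronizing.resetThreshold_le.{u, v} {Q : Type u} {α : Type v} [Finite Q]
    {A : PartialAutomaton Q α}
    (hA : A.IsSynchronizing) {D : ℕ} (hD : A.IsConnectedWithin D) {w : List α}
    (hw : (A.image Set.univ w).Nonempty) {k : ℕ}
    (hk : HasShortResets.{u, v} k) :
    A.resetThreshold ≤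
      w.length + A.rank w ^ k * (Nat.card Q + w.length + D + w.length) := by
  obtain ⟨l, t, hl, hlt⟩ := hA.exists_fixing_const hD hw
  have : Nonempty (A.image Set.univ w) := hw.to_subtype
  let step : A.image Set.univ w → {u : List α // u.length ≤ Nat.card Q + w.length + D} →
      A.image Set.univ w := fun p u => A.fixingStep w p u
  have hstep : ∀ (m : List {u : List α // u.length ≤ Nat.card Q + w.length + D}) p,
      m.foldl step p = (m.map Subtype.val).foldl (A.fixingStep w) p := by
    intro m p
    rw [List.foldl_map]
  obtain ⟨m, s, hm, hms⟩ := hk _ _ step ⟨l.attachWith _ hl, t, fun p => by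
    rw [hstep, List.attachWith_map_subtype_val, hlt]⟩
  obtain ⟨v, hv, hne, hsub⟩ := A.exists_word_of_fixing w (Nat.card Q + w.length + D)
    (m.map Subtype.val) (by simp +contextual) Set.univ Set.univ_nonempty
  rw [Set.image_univ, Subtype.range_coe, ← image_append] at hne hsub
  have hreset : A.IsReset (w ++ v) := by
    refine isReset_of_subset_singleton hne (t := s) (hsub.trans ?_)
    rintro _ ⟨p, -, rfl⟩
    rw [Set.mem_singleton_iff, ← hms p, hstep]
  refine hreset.resetThreshold_le.trans ?_
  rw [List.length_append]
  refine Nat.add_le_add_left (hv.trans (Nat.mul_le_mul_right _ ?_)) _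
  rw [List.length_map]
  exact hm

end PartialAutomaton

/-! ### Words of logarithmic rank in automata with a branching state -/

namespace PartialAutomaton

variable {Q α : Type*}

open Classical in
/-- The transition under a letter, made undefined when it enters the state `b`: the paths
returning to `b` are followed separately. -/
noncomputable def stepAvoiding (A : PartialAutomaton Q α) (b : Q) (c : α) (q : Q) : Option Q :=
  (A.step q c).bind fun p => if p = b then none else some p

theorem stepAvoiding_eq_some (A : PartialAutomaton Q α) {b q p : Q} {c : α} :
    A.stepAvoiding b c q = some p ↔ A.step q c = some p ∧ p ≠ b := by
  rw [stepAvoiding, Option.bind_eq_some_iff]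
  constructor
  · rintro ⟨r, hr, h⟩
    split_ifs at h with hrb
    obtain rfl := Option.some_injective _ h
    exact ⟨hr, hrb⟩
  · rintro ⟨h, hb⟩
    exact ⟨p, h, by rw [if_neg hb]⟩

/-- Positive weights of the states that, away from the state `b`, do not increase along
transitions and for which the letters `x` and `y` split the weight of a state between its two
successors. Both letters are defined at `b`. -/
structure IsBranchingWeight (A : PartialAutomaton Q α) (b : Q) (x y : α) (W : Q → ℕ) : Prop where
  left_defined : ∃ p, A.step b x = some p
  right_defined : ∃ p, A.step b y = some p
  one_le : ∀ q, 1 ≤ W q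
  mono : ∀ {q c p}, A.step q c = some p → p ≠ b → W p ≤ W q
  split : ∀ {q p p'}, A.step q x = some p → A.step q y = some p' → p ≠ b → p' ≠ b →
    W p + W p' ≤ W q

/-- The weight of an optional state, which is `0` for `none`. -/
def optionWeight (W : Q → ℕ) (o : Option Q) : ℕ := o.elim 0 W

/-- The total weight of a list of optional states, where the weight of the entry with index `k`
counts `(3 / 2) ^ k` times. -/
def agedWeight (W : Q → ℕ) : List (Option Q) → ℚ
  | [] => 0
  | o :: l => optionWeight W o + 3 / 2 * agedWeight W l

theorem agedWeight_nonneg (W : Q → ℕ) (l : List (Option Q)) : 0 ≤ agedWeight W l := by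
  induction l with
  | nil => exact le_rfl
  | cons o l ih => rw [agedWeight]; positivity

theorem pow_le_agedWeight {W : Q → ℕ} {q : Q} (hq : 1 ≤ W q) {l : List (Option Q)} {k : ℕ}
    (h : l[k]? = some (some q)) : (3 / 2 : ℚ) ^ k ≤ agedWeight W l := by
  induction l generalizing k with
  | nil => simp at h
  | cons o l ih =>
    rw [agedWeight]
    cases k with
    | zero =>
      obtain rfl : o = some q := by simpa using h
      have h1 := agedWeight_nonneg W l
      have h2 : (1 : ℚ) ≤ W q := by exact_mod_cast hq
      simp only [optionWeight, Option.elim_some, pow_zero]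
      linarith
    | succ k =>
      have h1 := ih (k := k) (by simpa using h)
      have h2 : (0 : ℚ) ≤ optionWeight W o := by positivity
      rw [pow_succ]
      linarith

namespace IsBranchingWeight

variable {A : PartialAutomaton Q α} {b : Q} {x y : α} {W : Q → ℕ}

theorem optionWeight_le (hW : A.IsBranchingWeight b x y W) (o : Option Q) (c : α) :
    optionWeight W (o.bind (A.stepAvoiding b c)) ≤ optionWeight W o := by
  cases o with
  | none => simp [optionWeight]
  | some q =>
    rw [Option.bind_some]
    cases h : A.stepAvoiding b c q with
    | none => simp [optionWeight]
    | some p =>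
      rw [stepAvoiding_eq_some] at h
      exact hW.mono h.1 h.2

theorem optionWeight_add_le (hW : A.IsBranchingWeight b x y W) (o : Option Q) :
    optionWeight W (o.bind (A.stepAvoiding b x)) + optionWeight W (o.bind (A.stepAvoiding b y)) ≤
      optionWeight W o := by
  have hx := hW.optionWeight_le o x
  have hy := hW.optionWeight_le o y
  cases o with
  | none => simp [optionWeight]
  | some q =>
    rw [Option.bind_some] at hx hy ⊢
    rw [Option.bind_some]
    cases h : A.stepAvoiding b x q with
    | none => simpa [optionWeight] using hy
    | some p =>
      cases h' : A.stepAvoiding b y q with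
      | none => rw [h] at hx; simpa [optionWeight] using hx
      | some p' =>
        rw [stepAvoiding_eq_some] at h h'
        exact hW.split h.1 h'.1 h.2 h'.2

theorem agedWeight_map_le (hW : A.IsBranchingWeight b x y W) (l : List (Option Q)) (c : α) :
    agedWeight W (l.map fun o => o.bind (A.stepAvoiding b c)) ≤ agedWeight W l := by
  induction l with
  | nil => exact le_rfl
  | cons o l ih =>
    have h : (optionWeight W (o.bind (A.stepAvoiding b c)) : ℚ) ≤ optionWeight W o := by
      exact_mod_cast hW.optionWeight_le o c
    rw [List.map_cons, agedWeight, agedWeight]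
    linarith

theorem agedWeight_map_add_le (hW : A.IsBranchingWeight b x y W) (l : List (Option Q)) :
    agedWeight W (l.map fun o => o.bind (A.stepAvoiding b x)) +
      agedWeight W (l.map fun o => o.bind (A.stepAvoiding b y)) ≤ agedWeight W l := by
  induction l with
  | nil => simp [agedWeight]
  | cons o l ih =>
    have h : (optionWeight W (o.bind (A.stepAvoiding b x)) : ℚ) +
        optionWeight W (o.bind (A.stepAvoiding b y)) ≤ optionWeight W o := by
      exact_mod_cast hW.optionWeight_add_le o
    simp only [List.map_cons, agedWeight]
    linarith

/-- A word is built letter by letter together with a list `l` of the states reached by paths that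
have visited `b`, indexed by age: the number of later times at which `b` was reached by some path.
All paths that visit `b` at the same time stay together, so one entry per age suffices. When `b`
is reached, one of the letters `x`, `y` halves the aged weight from `4 N` to `2 N`; the next visit
to `b` ages all entries and adds one for `b`, which gives at most `3 / 2 * 2 N + N = 4 N`. -/
theorem exists_word (hW : A.IsBranchingWeight b x y W) {N : ℕ} (hN : ∀ q, W q ≤ N)
    (hstep : ∀ q, ∃ c p, A.step q c = some p) (t : ℕ) :
    ∃ (w : List α) (l : List (Option Q)), w.length = t ∧ (A.image Set.univ w).Nonempty ∧
      (∀ q p, A.run q w = some p → some p ∈ l ∨ ∀ v, v <+: w → A.run q v ≠ some b) ∧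
      agedWeight W l ≤ 4 * N ∧ (b ∉ A.image Set.univ w → agedWeight W l ≤ 2 * N) := by
  have hN0 : (0 : ℚ) ≤ N := Nat.cast_nonneg N
  have hbN : (W b : ℚ) ≤ N := by exact_mod_cast hN b
  induction t with
  | zero =>
    refine ⟨[], [some b], rfl, ⟨b, b, Set.mem_univ b, rfl⟩, fun q p hp => ?_, ?_,
      fun h => (h ⟨b, Set.mem_univ b, rfl⟩).elim⟩
    · obtain rfl : q = p := Option.some_injective _ hp
      by_cases hq : q = b
      · exact Or.inl (by simp [hq])
      · refine Or.inr fun v hv => ?_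
        rw [List.prefix_nil.1 hv]
        simpa [run] using hq
    · simp only [agedWeight, optionWeight, Option.elim_some]
      linarith
  | succ t ih =>
    obtain ⟨w, l, hlen, hne, hl, h4, h2⟩ := ih
    obtain ⟨c, hc, hwt⟩ : ∃ c, (A.image Set.univ (w ++ [c])).Nonempty ∧
        agedWeight W (l.map fun o => o.bind (A.stepAvoiding b c)) ≤ 2 * N := by
      have himg : ∀ {q c p}, q ∈ A.image Set.univ w → A.step q c = some p →
          (A.image Set.univ (w ++ [c])).Nonempty := by
        intro q c p hq hp
        rw [image_append]
        exact ⟨p, q, hq, by simp [run, hp]⟩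
      by_cases hb : b ∈ A.image Set.univ w
      · have hsum := hW.agedWeight_map_add_le l
        rcases le_total (agedWeight W (l.map fun o => o.bind (A.stepAvoiding b x)))
          (agedWeight W (l.map fun o => o.bind (A.stepAvoiding b y))) with h | h
        · obtain ⟨p, hp⟩ := hW.left_defined
          exact ⟨x, himg hb hp, by linarith⟩
        · obtain ⟨p, hp⟩ := hW.right_defined
          exact ⟨y, himg hb hp, by linarith⟩
      · obtain ⟨q, hq⟩ := hne
        obtain ⟨c, p, hp⟩ := hstep q
        exact ⟨c, himg hq hp, (hW.agedWeight_map_le l c).trans (h2 hb)⟩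
    set l₀ := l.map fun o => o.bind (A.stepAvoiding b c) with hl₀
    have key : ∀ q p, A.run q (w ++ [c]) = some p → p ≠ b →
        some p ∈ l₀ ∨ ∀ v, v <+: w ++ [c] → A.run q v ≠ some b := by
      intro q p hp hpb
      rw [run_append_singleton, Option.bind_eq_some_iff] at hp
      obtain ⟨r, hr, hrp⟩ := hp
      rcases hl q r hr with h | h
      · exact Or.inl (List.mem_map.2 ⟨some r, h, A.stepAvoiding_eq_some.2 ⟨hrp, hpb⟩⟩)
      · refine Or.inr fun v hv => ?_
        rcases List.prefix_concat_iff.1 hv with rfl | hv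
        · rw [run_append_singleton, hr, Option.bind_some, hrp]
          simpa using hpb
        · exact h v hv
    by_cases hb : b ∈ A.image Set.univ (w ++ [c])
    · refine ⟨w ++ [c], some b :: l₀, by simp [hlen], hc, fun q p hp => ?_, ?_,
        fun h => (h hb).elim⟩
      · by_cases hpb : p = b
        · exact Or.inl (by simp [hpb])
        · exact (key q p hp hpb).imp_left (List.mem_cons_of_mem _)
      · simp only [agedWeight, optionWeight, Option.elim_some]
        linarith
    · refine ⟨w ++ [c], l₀, by simp [hlen], hc, fun q p hp => key q p hp ?_, by linarith,
        fun _ => hwt⟩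
      rintro rfl
      exact hb ⟨q, Set.mem_univ q, hp⟩

/-- If every path of length `H` visits `b`, then some word of length `H` has rank logarithmic in
the weights: a state of age `k` has aged weight at least `(3 / 2) ^ k`. -/
theorem exists_word_rank [Finite Q] (hW : A.IsBranchingWeight b x y W) {N : ℕ}
    (hN : ∀ q, W q ≤ N) (hstep : ∀ q, ∃ c p, A.step q c = some p) {H : ℕ}
    (hH : ∀ q w p, w.length = H → A.run q w = some p → ∃ v, v <+: w ∧ A.run q v = some b) :
    ∃ w : List α, w.length = H ∧ (A.image Set.univ w).Nonempty ∧
      (3 / 2 : ℚ) ^ (A.rank w - 1) ≤ 4 * N := by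
  obtain ⟨w, l, hlen, hne, hl, h4, -⟩ := hW.exists_word hN hstep H
  refine ⟨w, hlen, hne, ?_⟩
  have hidx : ∀ p ∈ A.image Set.univ w, ∃ k : ℕ, l[k]? = some (some p) := by
    rintro p ⟨q, -, hp⟩
    refine List.mem_iff_getElem?.1 ((hl q p hp).resolve_right fun h => ?_)
    obtain ⟨v, hv, hb⟩ := hH q w p hlen hp
    exact h v hv hb
  choose! idx hidx using hidx
  obtain ⟨p, hp, hk⟩ : ∃ p ∈ A.image Set.univ w, A.rank w - 1 ≤ idx p := by
    by_contra! h
    have h1 : (A.image Set.univ w).ncard ≤ (Set.Iio (A.rank w - 1)).ncard := by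
      refine Set.ncard_le_ncard_of_injOn idx (fun p hp => h p hp) (fun p hp q hq he => ?_)
        (Set.finite_Iio _)
      have := (hidx p hp).symm.trans (he ▸ hidx q hq)
      simpa using this
    have h2 : 0 < (A.image Set.univ w).ncard := (Set.ncard_pos (Set.toFinite _)).2 hne
    rw [Set.ncard_Iio_nat, rank] at h1
    omega
  exact (pow_le_pow_right₀ (by norm_num) hk).trans
    ((pow_le_agedWeight (hW.one_le p) (hidx p hp)).trans h4)

end IsBranchingWeight

end PartialAutomaton

/-! ### The literal automaton of a finite prefix code -/

section Literal

variable {α : Type*} {X : Set (List α)}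

theorem IsProperPrefixIn.of_prefix {u v : List α} (h : IsProperPrefixIn X v) (huv : u <+: v) :
    IsProperPrefixIn X u := by
  obtain ⟨w, hw, hvw, hne⟩ := h
  refine ⟨w, hw, huv.trans hvw, ?_⟩
  rintro rfl
  exact hne (hvw.eq_of_length_le huv.length_le)

theorem IsProperPrefixIn.notMem (hX : IsPrefixCode X) {u : List α} (h : IsProperPrefixIn X u) :
    u ∉ X := by
  obtain ⟨v, hv, huv, hne⟩ := h
  exact fun hu => hne (hX.2 u hu v hv huv)

theorem finite_literalState (hfin : X.Finite) : Finite (LiteralState X) := by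
  refine Set.Finite.subset (s := ⋃ v ∈ X, {u | u ∈ v.inits})
    (hfin.biUnion fun v _ => List.finite_toSet _) ?_
  rintro u ⟨v, hv, huv, -⟩
  exact Set.mem_biUnion hv ((List.mem_inits u v).2 huv)

theorem LiteralState.length_lt_card [Finite (LiteralState X)] (q : LiteralState X) :
    q.1.length < Nat.card (LiteralState X) := by
  let f : Fin (q.1.length + 1) → LiteralState X :=
    fun i => ⟨q.1.take i, q.2.of_prefix (List.take_prefix _ _)⟩
  have hf : Function.Injective f := by
    intro i j h
    have := congrArg (fun p : LiteralState X => p.1.length) h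
    simp only [f, List.length_take] at this
    omega
  have := Nat.card_le_card_of_injective f hf
  rwa [Nat.card_fin] at this

theorem length_le_card_literalState [Finite (LiteralState X)] (hX : IsPrefixCode X) {x : List α}
    (hx : x ∈ X) : x.length ≤ Nat.card (LiteralState X) := by
  have hpos : 0 < x.length := List.length_pos_iff.2 fun h => hX.1 (h ▸ hx)
  have h := LiteralState.length_lt_card (X := X) ⟨x.dropLast, x, hx, x.dropLast_prefix, fun h => by
    have := congrArg List.length h
    rw [List.length_dropLast] at this
    omega⟩
  simp only [List.length_dropLast] at h
  omega

namespace literalAutomaton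

theorem step_eq_some (hX : IsPrefixCode X) {q p : LiteralState X} {c : α} :
    (literalAutomaton X).step q c = some p ↔
      (q.1 ++ [c] ∈ X ∧ p.1 = []) ∨ p.1 = q.1 ++ [c] := by
  simp only [literalAutomaton]
  split_ifs with h h'
  · rw [Option.some_inj, Subtype.ext_iff]
    constructor
    · exact fun he => Or.inl ⟨h, he.symm⟩
    · rintro (⟨-, he⟩ | he)
      · exact he.symm
      · exact (p.2.notMem hX (he ▸ h)).elim
  · rw [Option.some_inj, Subtype.ext_iff]
    simp [h, eq_comm]
  · simp only [h, false_and, false_or, false_iff]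
    exact fun he => h' (he ▸ p.2)

theorem exists_step (hX : IsPrefixCode X) {q : LiteralState X} {c : α} {v : List α} (hv : v ∈ X)
    (h : q.1 ++ [c] <+: v) : ∃ p, (literalAutomaton X).step q c = some p := by
  by_cases he : q.1 ++ [c] = v
  · exact ⟨⟨[], q.2.of_prefix List.nil_prefix⟩, (step_eq_some hX).2 (Or.inl ⟨he ▸ hv, rfl⟩)⟩
  · exact ⟨⟨q.1 ++ [c], v, hv, h, he⟩, (step_eq_some hX).2 (Or.inr rfl)⟩

theorem exists_mem_of_step (hX : IsPrefixCode X) {q p : LiteralState X} {c : α}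
    (h : (literalAutomaton X).step q c = some p) : ∃ v ∈ X, q.1 ++ [c] <+: v := by
  rcases (step_eq_some hX).1 h with ⟨h, -⟩ | h
  · exact ⟨_, h, List.prefix_rfl⟩
  · obtain ⟨v, hv, hpv, -⟩ := p.2
    exact ⟨v, hv, h ▸ hpv⟩

theorem exists_letter (hX : IsPrefixCode X) (q : LiteralState X) :
    ∃ c p, (literalAutomaton X).step q c = some p := by
  obtain ⟨v, hv, ⟨t, ht⟩, hne⟩ := q.2
  cases t with
  | nil => simp [hne] at ht
  | cons c t =>
    obtain ⟨p, hp⟩ := exists_step hX (c := c) hv ⟨t, by simpa using ht⟩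
    exact ⟨c, p, hp⟩

theorem run_of_mem (hX : IsPrefixCode X) {q : LiteralState X} {y : List α} (h : q.1 ++ y ∈ X) :
    (literalAutomaton X).run q y = some ⟨[], q.2.of_prefix List.nil_prefix⟩ := by
  induction y generalizing q with
  | nil => rw [List.append_nil] at h; exact (q.2.notMem hX h).elim
  | cons c y ih =>
    rw [PartialAutomaton.run, Option.bind_eq_some_iff]
    by_cases hy : y = []
    · subst hy
      exact ⟨_, (step_eq_some hX).2 (Or.inl ⟨h, rfl⟩), rfl⟩
    · have h' : q.1 ++ [c] ++ y ∈ X := by simpa using h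
      let r : LiteralState X := ⟨q.1 ++ [c], _, h', List.prefix_append _ _, by simpa using hy⟩
      exact ⟨r, (step_eq_some hX).2 (Or.inr rfl), ih h'⟩

theorem run_of_eq_append (hX : IsPrefixCode X) {q p : LiteralState X} {y : List α}
    (h : p.1 = q.1 ++ y) : (literalAutomaton X).run q y = some p := by
  induction y generalizing q with
  | nil => rw [List.append_nil] at h; rw [Subtype.ext h]; rfl
  | cons c y ih =>
    rw [PartialAutomaton.run, Option.bind_eq_some_iff]
    have h' : p.1 = q.1 ++ [c] ++ y := by simpa using h
    let r : LiteralState X := ⟨q.1 ++ [c], p.2.of_prefix (h' ▸ List.prefix_append _ _)⟩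
    exact ⟨r, (step_eq_some hX).2 (Or.inr rfl), ih h'⟩

theorem isConnectedWithin [Finite (LiteralState X)] (hX : IsPrefixCode X) :
    (literalAutomaton X).IsConnectedWithin (2 * Nat.card (LiteralState X)) := by
  intro p q
  obtain ⟨v, hv, ⟨y, rfl⟩, -⟩ := p.2
  refine ⟨y ++ q.1, ?_, ?_⟩
  · have h1 := length_le_card_literalState hX hv
    have h2 := q.length_lt_card
    rw [List.length_append] at h1 ⊢
    omega
  · rw [PartialAutomaton.run_append_eq_some]
    exact ⟨_, run_of_mem hX hv, run_of_eq_append hX rfl⟩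

/-- A path either only descends in the tree of prefixes or returns to the empty word soon. -/
theorem run_visits_nil [Finite (LiteralState X)] (hX : IsPrefixCode X) {q p : LiteralState X}
    {w : List α} (h : (literalAutomaton X).run q w = some p) :
    p.1 = q.1 ++ w ∨ ∃ v e, v <+: w ∧ (literalAutomaton X).run q v = some e ∧ e.1 = [] ∧
      q.1.length + v.length ≤ Nat.card (LiteralState X) := by
  induction w generalizing q with
  | nil =>
    obtain rfl := Option.some_injective _ h
    simp
  | cons c w ih =>
    rw [PartialAutomaton.run, Option.bind_eq_some_iff] at h
    obtain ⟨r, hr, h⟩ := h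
    rcases (step_eq_some hX).1 hr with ⟨-, hr0⟩ | hr'
    · refine Or.inr ⟨[c], r, by simp, by simp [PartialAutomaton.run, hr], hr0, ?_⟩
      exact q.length_lt_card
    · rcases ih h with hp | ⟨v, e, hv, he, he0, hlen⟩
      · exact Or.inl (by rw [hp, hr']; simp)
      · refine Or.inr ⟨c :: v, e, by simpa using hv, by simp [PartialAutomaton.run, hr, he], he0, ?_⟩
        rw [hr', List.length_append] at hlen
        simp only [List.length_cons, List.length_nil] at hlen ⊢
        omega

/-! ### The branching state of a code with at least two words -/

theorem _root_.IsPrefixCode.exists_branching (hX : IsPrefixCode X) {v₀ v₁ : List α} (h₀ : v₀ ∈ X)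
    (h₁ : v₁ ∈ X) (hne : v₀ ≠ v₁) :
    ∃ (b : List α) (x y : α), x ≠ y ∧ (∀ v ∈ X, b <+: v) ∧ (∃ v ∈ X, b ++ [x] <+: v) ∧
      ∃ v ∈ X, b ++ [y] <+: v := by
  classical
  let P : ℕ → Prop := fun k => ∀ v ∈ X, v₀.take k <+: v
  let k := Nat.findGreatest P v₀.length
  have hP : P k := Nat.findGreatest_spec (P := P) (Nat.zero_le _) fun v _ => by simp
  have hk : k < v₀.length := by
    refine lt_of_le_of_ne (Nat.findGreatest_le _) fun h => hne (hX.2 _ h₀ _ h₁ ?_)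
    have := hP v₁ h₁
    rwa [h, List.take_length] at this
  have hP' : ¬ P (k + 1) := Nat.findGreatest_is_greatest (Nat.lt_succ_self k) hk
  simp only [P, not_forall] at hP'
  obtain ⟨v, hv, hv'⟩ := hP'
  obtain ⟨t, ht⟩ := hP v hv
  have htake : v₀.take (k + 1) = v₀.take k ++ [v₀[k]] := by simp
  cases t with
  | nil =>
    rw [List.append_nil] at ht
    have : v = v₀ := hX.2 v hv v₀ h₀ (ht ▸ List.take_prefix _ _)
    exact (hv' (this ▸ List.take_prefix _ _)).elim
  | cons y t =>
    refine ⟨v₀.take k, v₀[k], y, ?_, hP, ⟨v₀, h₀, htake ▸ List.take_prefix _ _⟩, v, hv, t,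
      by simpa using ht⟩
    rintro rfl
    exact hv' ⟨t, by rw [htake, List.append_assoc]; exact ht⟩

/-- The number of states that extend the word `u`. -/
noncomputable def extensionCount (X : Set (List α)) (u : List α) : ℕ :=
  {t : LiteralState X | u <+: t.1}.ncard

open Classical in
/-- The number of states extending a given state, plus one; but the states that are proper
prefixes of the branching word `b` have weight `1`, since `b` is on the only path from them. -/
noncomputable def prefixWeight (b : List α) (q : LiteralState X) : ℕ :=
  if b <+: q.1 then extensionCount X q.1 + 1 else 1

theorem prefixWeight_le [Finite (LiteralState X)] (b : List α) (q : LiteralState X) :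
    prefixWeight b q ≤ Nat.card (LiteralState X) + 1 := by
  have : extensionCount X q.1 ≤ Nat.card (LiteralState X) := Set.ncard_le_card _
  rw [prefixWeight]
  split_ifs <;> omega

theorem extensionCount_append_le [Finite (LiteralState X)] (u v : List α) :
    extensionCount X (u ++ v) ≤ extensionCount X u :=
  Set.ncard_le_ncard fun _ ht => (List.prefix_append u v).trans ht

theorem extensionCount_split [Finite (LiteralState X)] (q : LiteralState X) {x y : α}
    (hxy : x ≠ y) :
    extensionCount X (q.1 ++ [x]) + extensionCount X (q.1 ++ [y]) + 1 ≤ extensionCount X q.1 := by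
  have hdisj : Disjoint {t : LiteralState X | q.1 ++ [x] <+: t.1}
      {t : LiteralState X | q.1 ++ [y] <+: t.1} := by
    rw [Set.disjoint_left]
    intro t hx hy
    have := List.prefix_of_prefix_length_le hx hy (by simp)
    simp [hxy] at this
  have hq : q ∉ {t : LiteralState X | q.1 ++ [x] <+: t.1} ∪
      {t : LiteralState X | q.1 ++ [y] <+: t.1} := by
    rintro (h | h) <;> simpa using List.IsPrefix.length_le h
  rw [extensionCount, extensionCount, ← Set.ncard_union_eq hdisj,
    ← Set.ncard_insert_of_notMem hq]
  refine Set.ncard_le_ncard (Set.insert_subset List.prefix_rfl (Set.union_subset ?_ ?_))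
  · exact fun t ht => (List.prefix_append _ _).trans ht
  · exact fun t ht => (List.prefix_append _ _).trans ht

theorem prefix_or_prefix {b : LiteralState X} (hb : ∀ v ∈ X, b.1 <+: v) (q : LiteralState X) :
    q.1 <+: b.1 ∨ b.1 <+: q.1 := by
  obtain ⟨v, hv, hqv, -⟩ := q.2
  exact List.prefix_or_prefix_of_prefix hqv (hb v hv)

theorem isBranchingWeight [Finite (LiteralState X)] (hX : IsPrefixCode X) {b : LiteralState X}
    (hb : ∀ v ∈ X, b.1 <+: v) {x y : α} (hxy : x ≠ y) (hbx : ∃ v ∈ X, b.1 ++ [x] <+: v)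
    (hby : ∃ v ∈ X, b.1 ++ [y] <+: v) :
    (literalAutomaton X).IsBranchingWeight b x y (prefixWeight b.1) where
  left_defined := let ⟨_, hv, h⟩ := hbx; exists_step hX hv h
  right_defined := let ⟨_, hv, h⟩ := hby; exists_step hX hv h
  one_le q := by rw [prefixWeight]; split_ifs <;> omega
  mono {q c p} hp hpb := by
    by_cases h : b.1 <+: p.1
    · have hpc : p.1 = q.1 ++ [c] := by
        refine ((step_eq_some hX).1 hp).resolve_left fun h0 => hpb (Subtype.ext ?_)
        rw [h0.2] at h ⊢
        exact (List.prefix_nil.1 h).symm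
      have hq : b.1 <+: q.1 := by
        rw [hpc] at h
        refine (List.prefix_concat_iff.1 h).resolve_left fun h => hpb (Subtype.ext ?_)
        rw [hpc, h]
      rw [prefixWeight, prefixWeight, if_pos h, if_pos hq, hpc]
      exact Nat.succ_le_succ (extensionCount_append_le _ _)
    · rw [prefixWeight, if_neg h, prefixWeight]
      split_ifs <;> omega
  split {q p p'} hp hp' hpb hpb' := by
    by_cases hq : b.1 <+: q.1
    · have key : ∀ {c : α} {r : LiteralState X}, (literalAutomaton X).step q c = some r →
          r ≠ b → prefixWeight b.1 r ≤ extensionCount X (q.1 ++ [c]) + 1 := by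
        intro c r hr hrb
        rw [prefixWeight]
        split_ifs with h
        · rcases (step_eq_some hX).1 hr with ⟨-, h0⟩ | h1
          · refine (hrb (Subtype.ext ?_)).elim
            rw [h0] at h ⊢
            exact (List.prefix_nil.1 h).symm
          · rw [h1]
        · omega
      have h1 := key hp hpb
      have h2 := key hp' hpb'
      have h3 := extensionCount_split q hxy
      have h4 : prefixWeight b.1 q = extensionCount X q.1 + 1 := by rw [prefixWeight, if_pos hq]
      omega
    -- A proper prefix of `b` has only one outgoing letter.
    · exfalso
      have hqb := (prefix_or_prefix hb q).resolve_right hq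
      have hlt : q.1.length < b.1.length :=
        lt_of_le_of_ne hqb.length_le fun h => hq (hqb.eq_of_length h ▸ List.prefix_rfl)
      have key : ∀ {c : α} {r : LiteralState X}, (literalAutomaton X).step q c = some r →
          q.1 ++ [c] <+: b.1 := by
        intro c r hr
        obtain ⟨v, hv, hqv⟩ := exists_mem_of_step hX hr
        refine List.prefix_of_prefix_length_le hqv (hb v hv) ?_
        simpa using hlt
      have := List.prefix_of_prefix_length_le (key hp) (key hp') (by simp)
      simp [hxy] at this

/-- A path from a prefix of the branching word `b` first descends to `b`. -/
theorem run_visits_of_prefix (hX : IsPrefixCode X) {b : LiteralState X}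
    (hb : ∀ v ∈ X, b.1 <+: v) {q p : LiteralState X} {w : List α} (hq : q.1 <+: b.1)
    (h : (literalAutomaton X).run q w = some p) (hlen : b.1.length ≤ q.1.length + w.length) :
    ∃ v, v <+: w ∧ (literalAutomaton X).run q v = some b := by
  induction w generalizing q with
  | nil => exact ⟨[], List.prefix_rfl, by
      rw [Subtype.ext (hq.eq_of_length_le (by simpa using hlen))]; rfl⟩
  | cons c w ih =>
    by_cases hqb : q = b
    · exact ⟨[], List.nil_prefix, by rw [hqb]; rfl⟩
    have hlt : q.1.length < b.1.length :=
      lt_of_le_of_ne hq.length_le fun h => hqb (Subtype.ext (hq.eq_of_length h))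
    rw [PartialAutomaton.run, Option.bind_eq_some_iff] at h
    obtain ⟨r, hr, h⟩ := h
    have hrc : r.1 = q.1 ++ [c] := by
      refine ((step_eq_some hX).1 hr).resolve_left fun ⟨hmem, _⟩ => ?_
      have := (hb _ hmem).eq_of_length_le (by simpa using hlt)
      exact b.2.notMem hX (this ▸ hmem)
    have hrb : r.1 <+: b.1 := by
      rcases prefix_or_prefix hb r with h | h
      · exact h
      · rw [h.eq_of_length_le (by rw [hrc]; simpa using hlt)]
    obtain ⟨v, hv, hrv⟩ := ih hrb h (by
      rw [hrc, List.length_append]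
      simp only [List.length_cons, List.length_nil] at hlen ⊢
      omega)
    exact ⟨c :: v, by simpa using hv, by simp [PartialAutomaton.run, hr, hrv]⟩

theorem run_visits_branching [Finite (LiteralState X)] (hX : IsPrefixCode X) {b : LiteralState X}
    (hb : ∀ v ∈ X, b.1 <+: v) {q p : LiteralState X} {w : List α}
    (hlen : w.length = 2 * Nat.card (LiteralState X))
    (h : (literalAutomaton X).run q w = some p) :
    ∃ v, v <+: w ∧ (literalAutomaton X).run q v = some b := by
  rcases run_visits_nil hX h with hp | ⟨v, e, ⟨w', rfl⟩, he, he0, hv⟩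
  · have := p.length_lt_card
    rw [hp, List.length_append] at this
    omega
  · rw [PartialAutomaton.run_append_eq_some] at h
    obtain ⟨e', he', h⟩ := h
    obtain rfl := Option.some_injective _ (he.symm.trans he')
    obtain ⟨v', ⟨t, rfl⟩, hv'⟩ := run_visits_of_prefix hX hb (he0 ▸ List.nil_prefix) h (by
      have := b.length_lt_card
      rw [List.length_append] at hlen
      omega)
    exact ⟨v ++ v', ⟨t, by simp⟩, PartialAutomaton.run_append_eq_some _ |>.2 ⟨e, he, hv'⟩⟩

theorem exists_word_rank [Finite (LiteralState X)] (hX : IsPrefixCode X) {v₀ v₁ : List α}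
    (h₀ : v₀ ∈ X) (h₁ : v₁ ∈ X) (hne : v₀ ≠ v₁) :
    ∃ w : List α, w.length = 2 * Nat.card (LiteralState X) ∧
      ((literalAutomaton X).image Set.univ w).Nonempty ∧
      (3 / 2 : ℚ) ^ ((literalAutomaton X).rank w - 1) ≤ 4 * (Nat.card (LiteralState X) + 1) := by
  obtain ⟨u, x, y, hxy, hu, ⟨v, hv, hx⟩, hy⟩ := hX.exists_branching h₀ h₁ hne
  let b : LiteralState X := ⟨u, v, hv, hu v hv, by
    rintro rfl
    simpa using hx.length_le⟩
  obtain ⟨w, hw, hne, hr⟩ := (isBranchingWeight hX (b := b) hu hxy ⟨v, hv, hx⟩ hy).exists_word_rank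
    (prefixWeight_le _) (exists_letter hX) fun q w p hw h => run_visits_branching hX hu hw h
  exact ⟨w, hw, hne, by exact_mod_cast hr⟩

/-! ### Codes with one word -/

theorem exists_run_of_length (hX : IsPrefixCode X) (q : LiteralState X) (m : ℕ) :
    ∃ v p, v.length = m ∧ (literalAutomaton X).run q v = some p := by
  induction m generalizing q with
  | zero => exact ⟨[], q, rfl, rfl⟩
  | succ m ih =>
    obtain ⟨c, r, hr⟩ := exists_letter hX q
    obtain ⟨v, p, hv, hp⟩ := ih r
    exact ⟨c :: v, p, by simp [hv], by simp [PartialAutomaton.run, hr, hp]⟩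

section Singleton

variable {x : List α}

theorem length_lt_of_singleton (q : LiteralState ({x} : Set (List α))) :
    q.1.length < x.length := by
  obtain ⟨v, rfl, h, hne⟩ := q.2
  exact lt_of_le_of_ne h.length_le fun he => hne (h.eq_of_length he)

theorem eq_of_length_modEq {p q : LiteralState ({x} : Set (List α))}
    (h : p.1.length ≡ q.1.length [MOD x.length]) : p = q := by
  have h := Nat.ModEq.eq_of_lt_of_lt h (length_lt_of_singleton p) (length_lt_of_singleton q)
  obtain ⟨v, rfl, hp, -⟩ := p.2
  obtain ⟨w, rfl, hq, -⟩ := q.2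
  exact Subtype.ext ((List.prefix_of_prefix_length_le hp hq h.le).eq_of_length h)

theorem run_length_modEq (hX : IsPrefixCode ({x} : Set (List α)))
    {p q : LiteralState ({x} : Set (List α))} {w : List α}
    (h : (literalAutomaton {x}).run q w = some p) :
    p.1.length ≡ q.1.length + w.length [MOD x.length] := by
  induction w generalizing q with
  | nil => rw [Option.some_injective _ h]; rfl
  | cons c w ih =>
    rw [PartialAutomaton.run, Option.bind_eq_some_iff] at h
    obtain ⟨r, hr, h⟩ := h
    refine (ih h).trans ?_
    rw [List.length_cons, add_comm w.length, ← add_assoc]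
    refine Nat.ModEq.add_right _ ?_
    rcases (step_eq_some hX).1 hr with ⟨hx, h0⟩ | h1
    · have hl : q.1.length + 1 = x.length := by
        simpa using congrArg List.length (Set.mem_singleton_iff.1 hx)
      rw [h0, hl]
      simp [Nat.ModEq]
    · rw [h1, List.length_append]
      rfl

theorem eq_of_run_singleton (hX : IsPrefixCode ({x} : Set (List α)))
    {p p' q : LiteralState ({x} : Set (List α))} {u v : List α}
    (hu : (literalAutomaton {x}).run q u = some p) (hv : (literalAutomaton {x}).run q v = some p')
    (hlen : u.length = v.length) : u = v := by
  induction u generalizing q v with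
  | nil => exact (List.length_eq_zero_iff.1 hlen.symm).symm
  | cons c u ih =>
    cases v with
    | nil => simp at hlen
    | cons d v =>
      rw [PartialAutomaton.run, Option.bind_eq_some_iff] at hu hv
      obtain ⟨r, hr, hu⟩ := hu
      obtain ⟨s, hs, hv⟩ := hv
      obtain ⟨_, rfl, h1⟩ := exists_mem_of_step hX hr
      obtain ⟨_, rfl, h2⟩ := exists_mem_of_step hX hs
      have : q.1 ++ [c] <+: q.1 ++ [d] := List.prefix_of_prefix_length_le h1 h2 (by simp)
      obtain rfl : c = d := by simpa using this
      rw [hr] at hs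
      obtain rfl := Option.some_injective _ hs
      rw [ih hu hv (by simpa using hlen)]

/-- The literal automaton of a single word `x` is a cycle. The word of length `|x|` read from a
state `q` determines all words read from `q`, so if some word is defined at `q` only, then this
one is. -/
theorem resetThreshold_singleton_le (hX : IsPrefixCode ({x} : Set (List α)))
    (hs : (literalAutomaton ({x} : Set (List α))).IsSynchronizing) :
    (literalAutomaton ({x} : Set (List α))).resetThreshold ≤ x.length := by
  obtain ⟨y, hy⟩ := hs
  obtain ⟨t, ht⟩ := hy.exists_image_eq
  obtain ⟨q, -, hq⟩ : t ∈ (literalAutomaton {x}).image Set.univ y := by rw [ht]; rfl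
  obtain ⟨v, p, hv, hp⟩ := exists_run_of_length hX q x.length
  have hcycle : ∀ {q p}, (literalAutomaton {x}).run q v = some p → p = q := fun h =>
    eq_of_length_modEq ((run_length_modEq hX h).trans (by simp [hv, Nat.ModEq]))
  obtain rfl := hcycle hp
  rw [← hv]
  refine (PartialAutomaton.isReset_of_subset_singleton (t := p) ⟨p, p, Set.mem_univ _, hp⟩
    ?_).resetThreshold_le
  rintro r' ⟨r, -, hr⟩
  obtain rfl : r = r' := (hcycle hr).symm
  have hdef : ∀ (m : ℕ) (u : List α), u.length = m → ∀ s,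
      (literalAutomaton {x}).run p u = some s →
        ∃ s', (literalAutomaton {x}).run r u = some s' := by
    intro m
    induction m using Nat.strong_induction_on with
    | _ m ih =>
      intro u hu s hs
      rcases le_total u.length v.length with hle | hle
      · rw [← List.take_append_drop u.length v, PartialAutomaton.run_append_eq_some] at hp hr
        obtain ⟨a, ha, -⟩ := hp
        obtain ⟨a', ha', -⟩ := hr
        rw [eq_of_run_singleton hX hs ha (by simpa using hle)]
        exact ⟨a', ha'⟩
      · rw [← List.take_append_drop v.length u, PartialAutomaton.run_append_eq_some] at hs
        obtain ⟨a, ha, hs⟩ := hs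
        have htake : u.take v.length = v := eq_of_run_singleton hX ha hp (by simpa using hle)
        rw [htake, hp] at ha
        obtain rfl := Option.some_injective _ ha
        have hpos : 0 < v.length := by
          rw [hv]
          exact (Nat.zero_le _).trans_lt (length_lt_of_singleton p)
        obtain ⟨s', hs'⟩ := ih (u.drop v.length).length (by rw [List.length_drop]; omega) _ rfl s hs
        refine ⟨s', ?_⟩
        rw [← List.take_append_drop v.length u, htake, PartialAutomaton.run_append_eq_some]
        exact ⟨r, hr, hs'⟩
  obtain ⟨s, hrs⟩ := hdef _ y rfl t hq
  have hst : s ∈ (literalAutomaton {x}).image Set.univ y := ⟨r, Set.mem_univ _, hrs⟩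
  rw [ht] at hst
  obtain rfl := Set.mem_singleton_iff.1 hst
  exact eq_of_length_modEq (Nat.ModEq.add_right_cancel' y.length
    ((run_length_modEq hX hrs).symm.trans (run_length_modEq hX hq)))

end Singleton

end literalAutomaton

end Literal

/-! ### Logarithmic bounds for the reset threshold -/

/-- The reset threshold is bounded in terms of a rank `r` that is logarithmic in the number of
states. -/
theorem literalAutomaton.exists_resetThreshold_le.{u} {α : Type u} {X : Set (List α)}
    (hfin : X.Finite) (hX : IsPrefixCode X) (hs : (literalAutomaton X).IsSynchronizing) {k : ℕ}
    (hk : HasShortResets.{u, u} k) :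
    ∃ r : ℕ, 1 ≤ r ∧ (3 / 2 : ℚ) ^ (r - 1) ≤ 4 * (Nat.card (LiteralState X) + 1) ∧
      (literalAutomaton X).resetThreshold ≤ 9 * Nat.card (LiteralState X) * r ^ k := by
  have := finite_literalState hfin
  obtain ⟨v₀, h₀⟩ : X.Nonempty := by
    obtain ⟨w, hw⟩ := hs
    obtain ⟨t, -⟩ := hw.exists_image_eq
    obtain ⟨v, hv, -⟩ := t.2
    exact ⟨v, hv⟩
  by_cases hsing : ∃ v₁ ∈ X, v₀ ≠ v₁
  · obtain ⟨v₁, h₁, hne⟩ := hsing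
    obtain ⟨w, hw, hne, hr⟩ := literalAutomaton.exists_word_rank hX h₀ h₁ hne
    have hpos : 1 ≤ (literalAutomaton X).rank w := (Set.ncard_pos (Set.toFinite _)).2 hne
    refine ⟨_, hpos, hr, (hs.resetThreshold_le (literalAutomaton.isConnectedWithin hX) hne
      hk).trans ?_⟩
    have hpow : 1 ≤ (literalAutomaton X).rank w ^ k := Nat.one_le_pow _ _ hpos
    rw [hw]
    nlinarith [Nat.mul_le_mul_left (Nat.card (LiteralState X)) hpow]
  · push Not at hsing
    obtain rfl : X = {v₀} := Set.eq_singleton_iff_unique_mem.2 ⟨h₀, fun v hv => (hsing v hv).symm⟩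
    refine ⟨1, le_rfl, ?_, ?_⟩
    · have : (0 : ℚ) ≤ Nat.card (LiteralState ({v₀} : Set (List α))) := Nat.cast_nonneg _
      rw [Nat.sub_self, pow_zero]
      linarith
    · rw [one_pow, mul_one]
      have h1 := literalAutomaton.resetThreshold_singleton_le hX hs
      have h2 := length_le_card_literalState hX h₀
      omega

theorem le_mul_log_of_pow_le {n r : ℕ} (hn : 2 ≤ n) (h : (3 / 2 : ℚ) ^ (r - 1) ≤ 4 * (n + 1)) :
    (r : ℝ) ≤ (4 / Real.log (3 / 2) + 1 / Real.log 2) * Real.log n := by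
  have hn' : (2 : ℝ) ≤ n := by exact_mod_cast hn
  have h32 : 0 < Real.log (3 / 2) := Real.log_pos (by norm_num)
  have h2 : 0 < Real.log 2 := Real.log_pos (by norm_num)
  have hpow : (3 / 2 : ℝ) ^ (r - 1) ≤ (n : ℝ) ^ 4 := by
    have h1 : (3 / 2 : ℝ) ^ (r - 1) ≤ 4 * (n + 1) := by
      have := (Rat.cast_le (K := ℝ)).2 h
      push_cast at this
      exact this
    have h3 : (8 : ℝ) ≤ (n : ℝ) ^ 3 := by
      calc (8 : ℝ) = 2 ^ 3 := by norm_num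
        _ ≤ (n : ℝ) ^ 3 := by gcongr
    calc (3 / 2 : ℝ) ^ (r - 1) ≤ 4 * (n + 1) := h1
      _ ≤ 8 * n := by linarith
      _ ≤ (n : ℝ) ^ 3 * n := by gcongr
      _ = (n : ℝ) ^ 4 := by ring
  have hlog := Real.log_le_log (by positivity) hpow
  rw [Real.log_pow, Real.log_pow] at hlog
  have h4 : ((r - 1 : ℕ) : ℝ) ≤ 4 / Real.log (3 / 2) * Real.log n := by
    rw [div_mul_eq_mul_div, le_div_iff₀ h32]
    exact_mod_cast hlog
  have h5 : 1 ≤ 1 / Real.log 2 * Real.log n := by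
    rw [div_mul_eq_mul_div, one_mul, le_div_iff₀ h2, one_mul]
    exact Real.log_le_log (by norm_num) hn'
  have h6 : (r : ℝ) ≤ ((r - 1 : ℕ) : ℝ) + 1 := by
    have : r ≤ (r - 1) + 1 := by omega
    exact_mod_cast this
  rw [add_mul]
  linarith

theorem literalAutomaton.resetThreshold_le_log.{u} {k : ℕ} (hk : HasShortResets.{u, u} k) :
    ∃ C : ℝ, ∀ (α : Type u) [Finite α] (X : Set (List α)), X.Finite → IsPrefixCode X →
      (literalAutomaton X).IsSynchronizing →
        ((literalAutomaton X).resetThreshold : ℝ) ≤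
          C * (Nat.card (LiteralState X) : ℝ) * Real.log (Nat.card (LiteralState X) : ℝ) ^ k := by
  refine ⟨9 * (4 / Real.log (3 / 2) + 1 / Real.log 2) ^ k, fun α _ X hfin hX hs => ?_⟩
  have := finite_literalState hfin
  have h32 : 0 < Real.log (3 / 2) := Real.log_pos (by norm_num)
  have h2 : 0 < Real.log 2 := Real.log_pos (by norm_num)
  by_cases hn : 2 ≤ Nat.card (LiteralState X)
  · obtain ⟨r, -, hr, hle⟩ := literalAutomaton.exists_resetThreshold_le hfin hX hs hk
    have hrlog := le_mul_log_of_pow_le hn hr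
    calc ((literalAutomaton X).resetThreshold : ℝ)
        ≤ 9 * Nat.card (LiteralState X) * (r : ℝ) ^ k := by exact_mod_cast hle
      _ ≤ 9 * Nat.card (LiteralState X) *
          ((4 / Real.log (3 / 2) + 1 / Real.log 2) *
            Real.log (Nat.card (LiteralState X))) ^ k := by gcongr
      _ = _ := by rw [mul_pow]; ring
  -- With one state, the empty word is a reset word.
  · have hle : (literalAutomaton X).resetThreshold ≤ 0 := by
      obtain ⟨w, hw⟩ := hs
      obtain ⟨t, ht⟩ := hw.exists_image_eq
      have : Subsingleton (LiteralState X) :=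
        Finite.card_le_one_iff_subsingleton.1 (by omega)
      exact (PartialAutomaton.isReset_of_subset_singleton (w := []) (t := t)
        ⟨t, t, Set.mem_univ t, rfl⟩ fun q _ => Subsingleton.elim q t).resetThreshold_le
    rw [Nat.le_zero.1 hle, Nat.cast_zero]
    have := Real.log_natCast_nonneg (Nat.card (LiteralState X))
    positivity

theorem corollary3p23 :
    (∃ C : ℝ, ∀ (α : Type*) [Finite α] (X : Set (List α)), X.Finite → IsPrefixCode X →
      (literalAutomaton X).IsSynchronizing →
        ((literalAutomaton X).resetThreshold : ℝ) ≤
          C * (Nat.card (LiteralState X) : ℝ) * Real.log (Nat.card (LiteralState X) : ℝ) ^ 3) ∧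
    (CernyConjecture →
      ∃ C : ℝ, ∀ (α : Type*) [Finite α] (X : Set (List α)), X.Finite → IsPrefixCode X →
        (literalAutomaton X).IsSynchronizing →
          ((literalAutomaton X).resetThreshold : ℝ) ≤
            C * (Nat.card (LiteralState X) : ℝ) *
              Real.log (Nat.card (LiteralState X) : ℝ) ^ 2) := by
  exact ⟨literalAutomaton.resetThreshold_le_log hasShortResets_three,
    fun h => literalAutomaton.resetThreshold_le_log h.hasShortResets_two⟩
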